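/- For each $n\ge 1$ consider $n$ actors with assigned treatments $c_{n,1},\dots,c_{n,n}\in\{A,B\}$ (random or deterministic) and treatments actually received $d_{n,1},\dots,d_{n,n}\in\{A,B\}$, defined on a probability space that may depend on $n$. Suppose interference follows Bernoulli switching: for every $n$ the events $\{d_{n,i}\neq c_{n,i}\}$, $i=1,\dots,n$, are independent and have probabilities $p_i=p_{n,i}\in[0,1]$ (which may, but need not, depend on $n$). Let $n_S=\sum_{i=1}^n \mathbb{I}(c_{n,i}=d_{n,i})$ be the number of actors who receive the assigned treatment, let $n_D=n-n_S$ be the number of those who receive the opposite one, and put $$s_n=\Big(\sum_{i=1}^n p_i(1-p_i)\Big)^{1/2},\qquad \mu_{\mathbf p}=n-2\sum_{i=1}^n p_i .$$ If $s_n\to\infty$ as $n\to\infty$, then $$\frac{n_S-n_D-\mu_{\mathbf p}}{2s_n}\;\xrightarrow{D}\;N(0,1)\qquad (n\to\infty).$$ -/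

import Mathlib

open MeasureTheory ProbabilityTheory Filter

/-- The two treatments (class labels) of an A/B test. -/
inductive Treatment : Type
  | A
  | B
  deriving DecidableEq

/-- The two-point set of treatments carries the discrete sigma-algebra. -/
instance Treatment.instMeasurableSpace : MeasurableSpace Treatment := ⊤

/-- `n_S`: the number of actors whose received label agrees with the assigned one. -/
def numSame {n : ℕ} (c d : Fin n → Treatment) : ℕ :=
  ∑ j : Fin n, if c j = d j then 1 else 0

/-- `n_D = n - n_S`: the number of actors whose label was changed by interference.
The subtraction never truncates, see `numSame_le`. -/
def numDiff {n : ℕ} (c d : Fin n → Treatment) : ℕ :=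
  n - numSame c d

theorem numSame_le {n : ℕ} (c d : Fin n → Treatment) : numSame c d ≤ n := by
  unfold numSame
  calc ∑ j : Fin n, (if c j = d j then 1 else 0) ≤ ∑ _j : Fin n, 1 :=
        Finset.sum_le_sum fun j _ => by split_ifs <;> simp
    _ = n := by simp

/-- Bernoulli switching for `n` actors: `c` are the assigned labels (random, or deterministic when
`c i` is constant), `d` the labels after interference. The events "actor `i` receives the
treatment opposite to the assigned one" are independent and the `i`-th has probability `p i`. -/
structure IsBernoulliSwitching {Ω : Type*} [MeasurableSpace Ω] (μ : Measure Ω) {n : ℕ}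
    (p : Fin n → ℝ) (c d : Fin n → Ω → Treatment) : Prop where
  measurable_assigned : ∀ i, Measurable (c i)
  measurable_received : ∀ i, Measurable (d i)
  indep : iIndepSet (fun i => {ω | d i ω ≠ c i ω}) μ
  prob : ∀ i, μ.real {ω | d i ω ≠ c i ω} = p i

/-- `s_n`, the nonnegative square root of `∑ p_i (1 - p_i)`. -/
noncomputable def switchingSD {n : ℕ} (p : Fin n → ℝ) : ℝ :=
  Real.sqrt (∑ i, p i * (1 - p i))

/-- `μ_p = n - 2 ∑ p_i`. -/
noncomputable def switchingMean {n : ℕ} (p : Fin n → ℝ) : ℝ :=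
  (n : ℝ) - 2 * ∑ i, p i

open scoped Topology NNReal

/-!
The sign `±1` recording whether an actor receives the assigned treatment has mean `1 - 2 p_i` and
variance `4 p_i (1 - p_i)`, and `n_S - n_D` is the sum of these independent signs, so the claim is
the central limit theorem for uniformly bounded independent variables whose total variance
diverges. That in turn is a case of Lyapunov's theorem: the characteristic functions of a centred
variable and of the Gaussian with the same variance both agree with `1 - σ² t² / 2` up to
`O(|t|³ E|X|³)`. Factors of modulus at most one make these errors add up over a product, and after
normalisation by `s_n` the sum of the third moments is at most of order `1 / s_n`.
-/

section ElementaryEstimates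

theorem norm_prod_sub_prod_le_sum_norm_sub {ι R : Type*} [NormedCommRing R] [NormOneClass R]
    (s : Finset ι) {a b : ι → R} (ha : ∀ i ∈ s, ‖a i‖ ≤ 1) (hb : ∀ i ∈ s, ‖b i‖ ≤ 1) :
    ‖∏ i ∈ s, a i - ∏ i ∈ s, b i‖ ≤ ∑ i ∈ s, ‖a i - b i‖ := by
  induction s using Finset.cons_induction with
  | empty => simp
  | cons j s hj ih =>
    rw [Finset.forall_mem_cons] at ha hb
    have norm_prod_b_le : ‖∏ i ∈ s, b i‖ ≤ 1 :=
      (s.norm_prod_le b).trans (Finset.prod_le_one (fun _ _ => norm_nonneg _) hb.2)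
    rw [Finset.prod_cons, Finset.prod_cons, Finset.sum_cons]
    calc ‖a j * ∏ i ∈ s, a i - b j * ∏ i ∈ s, b i‖
        = ‖(a j - b j) * ∏ i ∈ s, b i + a j * (∏ i ∈ s, a i - ∏ i ∈ s, b i)‖ := by ring_nf
      _ ≤ ‖a j - b j‖ * ‖∏ i ∈ s, b i‖ + ‖a j‖ * ‖∏ i ∈ s, a i - ∏ i ∈ s, b i‖ :=
        (norm_add_le _ _).trans (add_le_add (norm_mul_le _ _) (norm_mul_le _ _))
      _ ≤ ‖a j - b j‖ * 1 + 1 * ∑ i ∈ s, ‖a i - b i‖ := by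
        gcongr
        exacts [ha.1, ih ha.2 hb.2]
      _ = ‖a j - b j‖ + ∑ i ∈ s, ‖a i - b i‖ := by ring

theorem norm_cexp_mul_I_sub_taylor_two_le (x : ℝ) :
    ‖Complex.exp (x * Complex.I) - (1 + x * Complex.I - x ^ 2 / 2)‖ ≤ 4 * |x| ^ 3 := by
  have norm_mul_I : ‖(x * Complex.I : ℂ)‖ = |x| := by simp
  rcases le_total |x| 1 with hx | hx
  · have taylor : ∑ m ∈ Finset.range 3, (x * Complex.I) ^ m / (m.factorial : ℂ)
        = 1 + x * Complex.I - x ^ 2 / 2 := by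
      simp [Finset.sum_range_succ, mul_pow, sub_eq_add_neg, neg_div]
    have remainder := Complex.exp_bound (norm_mul_I.trans_le hx) (n := 3) (by norm_num)
    rw [taylor, norm_mul_I] at remainder
    refine remainder.trans ?_
    rw [mul_comm 4]
    gcongr
    norm_num [Nat.factorial]
  · calc ‖Complex.exp (x * Complex.I) - (1 + x * Complex.I - x ^ 2 / 2)‖
        ≤ ‖Complex.exp (x * Complex.I)‖
          + (‖(1 : ℂ)‖ + ‖(x * Complex.I : ℂ)‖ + ‖(x ^ 2 / 2 : ℂ)‖) :=
        (norm_sub_le _ _).trans <| by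
          gcongr
          exact (norm_sub_le _ _).trans (by gcongr; exact norm_add_le _ _)
      _ = 2 + |x| + |x| ^ 2 / 2 := by
        have norm_half_sq : ‖(x ^ 2 / 2 : ℂ)‖ = |x| ^ 2 / 2 := by simp
        rw [Complex.norm_exp_ofReal_mul_I, norm_mul_I, norm_half_sq, norm_one]
        ring
      _ ≤ 4 * |x| ^ 3 := by nlinarith [mul_self_nonneg (|x| - 1)]

theorem abs_exp_neg_sq_div_two_sub_le (x : ℝ) :
    |Real.exp (-(x ^ 2 / 2)) - (1 - x ^ 2 / 2)| ≤ |x| ^ 3 := by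
  have lower := Real.add_one_le_exp (-(x ^ 2 / 2))
  rw [abs_of_nonneg (by linarith)]
  rcases le_total |x| 1 with hx | hx
  · have half_sq_le_one : |-(x ^ 2 / 2)| ≤ 1 := by
      rw [abs_neg, abs_of_nonneg (by positivity), ← sq_abs]
      nlinarith [abs_nonneg x]
    calc Real.exp (-(x ^ 2 / 2)) - (1 - x ^ 2 / 2)
        = Real.exp (-(x ^ 2 / 2)) - 1 - -(x ^ 2 / 2) := by ring
      _ ≤ (-(x ^ 2 / 2)) ^ 2 :=
        (le_abs_self _).trans (Real.abs_exp_sub_one_sub_id_le half_sq_le_one)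
      _ = |x| ^ 3 * (|x| / 4) := by rw [← sq_abs x]; ring
      _ ≤ |x| ^ 3 := mul_le_of_le_one_right (by positivity) (by linarith)
  · have exp_le_one : Real.exp (-(x ^ 2 / 2)) ≤ 1 :=
      Real.exp_le_one_iff.2 (by linarith [sq_nonneg x])
    calc Real.exp (-(x ^ 2 / 2)) - (1 - x ^ 2 / 2) ≤ |x| ^ 2 := by
          rw [sq_abs]
          nlinarith [sq_nonneg x]
      _ ≤ |x| ^ 3 := pow_le_pow_right₀ hx (by norm_num)

end ElementaryEstimates

section Moments

variable {Ω : Type*} [MeasurableSpace Ω] {μ : Measure Ω} {X : Ω → ℝ}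

theorem integrable_abs_pow_three (hX : MemLp X 3 μ) : Integrable (fun ω => |X ω| ^ 3) μ :=
  hX.integrable_norm_pow (by norm_num)

variable [IsProbabilityMeasure μ]

-- Integrating `3 σ x² ≤ σ³ + 2 |x|³` at the standard deviation `σ` avoids Hölder's inequality.
theorem sqrt_variance_pow_three_le (hX : MemLp X 3 μ) (hmean : μ[X] = 0) :
    √(Var[X; μ]) ^ 3 ≤ ∫ ω, |X ω| ^ 3 ∂μ := by
  set σ := √(Var[X; μ])
  have hσ : 0 ≤ σ := Real.sqrt_nonneg _
  have integral_sq : ∫ ω, X ω ^ 2 ∂μ = σ ^ 2 := by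
    rw [Real.sq_sqrt (variance_nonneg _ _), variance_of_integral_eq_zero hX.aemeasurable hmean]
  have weighted_am_gm (x : ℝ) : 3 * σ * x ^ 2 ≤ σ ^ 3 + 2 * |x| ^ 3 := by
    rw [← sq_abs x]
    have factored : 0 ≤ (|x| - σ) ^ 2 * (2 * |x| + σ) :=
      mul_nonneg (sq_nonneg _) (add_nonneg (by positivity) hσ)
    linarith
  have integrated : ∫ ω, 3 * σ * X ω ^ 2 ∂μ ≤ ∫ ω, (σ ^ 3 + 2 * |X ω| ^ 3) ∂μ :=
    integral_mono ((hX.mono_exponent (by norm_num)).integrable_sq.const_mul _)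
      ((integrable_const _).add ((integrable_abs_pow_three hX).const_mul _))
      fun ω => weighted_am_gm (X ω)
  rw [integral_const_mul, integral_sq,
    integral_add (integrable_const _) ((integrable_abs_pow_three hX).const_mul _),
    integral_const_mul, integral_const, probReal_univ, one_smul] at integrated
  linarith

theorem integral_abs_pow_three_le_mul_variance (hX : AEMeasurable X μ) (hmean : μ[X] = 0) {b : ℝ}
    (hb : ∀ᵐ ω ∂μ, |X ω| ≤ b) : ∫ ω, |X ω| ^ 3 ∂μ ≤ b * Var[X; μ] := by
  have hX_memLp (p) : MemLp X p μ := .of_bound hX.aestronglyMeasurable b hb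
  rw [variance_of_integral_eq_zero hX hmean, ← integral_const_mul]
  refine integral_mono_ae (integrable_abs_pow_three (hX_memLp 3))
    ((hX_memLp 2).integrable_sq.const_mul b) ?_
  filter_upwards [hb] with ω hω
  calc |X ω| ^ 3 = |X ω| * X ω ^ 2 := by rw [← sq_abs (X ω)]; ring
    _ ≤ b * X ω ^ 2 := by gcongr

end Moments

section CharFun

variable {Ω : Type*} [MeasurableSpace Ω] {μ : Measure Ω} [IsProbabilityMeasure μ]

theorem integral_taylor_two_cexp_mul_I {X : Ω → ℝ} (hX : MemLp X 2 μ) (hmean : μ[X] = 0) (t : ℝ) :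
    ∫ ω, (1 + (t * X ω : ℝ) * Complex.I - (t * X ω : ℝ) ^ 2 / 2 : ℂ) ∂μ
      = (1 - Var[X; μ] * t ^ 2 / 2 : ℝ) := by
  have hX_int : Integrable (fun ω => (X ω : ℂ)) μ := (hX.integrable (by norm_num)).ofReal
  have hX_sq_int : Integrable (fun ω => ((X ω ^ 2 : ℝ) : ℂ)) μ := hX.integrable_sq.ofReal
  have hlinear_int : Integrable (fun ω => 1 + X ω * (t * Complex.I) : Ω → ℂ) μ :=
    (integrable_const _).add (hX_int.mul_const _)
  calc ∫ ω, (1 + (t * X ω : ℝ) * Complex.I - (t * X ω : ℝ) ^ 2 / 2 : ℂ) ∂μ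
      = ∫ ω, (1 + X ω * (t * Complex.I) - (X ω ^ 2 : ℝ) * (t ^ 2 / 2) : ℂ) ∂μ := by
        congr with ω
        push_cast
        ring
    _ = 1 + (∫ ω, (X ω : ℂ) ∂μ) * (t * Complex.I)
        - (∫ ω, ((X ω ^ 2 : ℝ) : ℂ) ∂μ) * (t ^ 2 / 2) := by
        rw [integral_sub hlinear_int (hX_sq_int.mul_const _),
          integral_add (integrable_const _) (hX_int.mul_const _), integral_mul_const,
          integral_mul_const, integral_const, probReal_univ, one_smul]
    _ = (1 - Var[X; μ] * t ^ 2 / 2 : ℝ) := by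
        rw [integral_complex_ofReal, integral_complex_ofReal, hmean,
          ← variance_of_integral_eq_zero hX.aemeasurable hmean]
        push_cast
        ring

theorem norm_charFun_map_sub_taylor_two_le {X : Ω → ℝ} (hX : MemLp X 3 μ) (hmean : μ[X] = 0)
    (t : ℝ) :
    ‖charFun (μ.map X) t - (1 - Var[X; μ] * t ^ 2 / 2 : ℝ)‖
      ≤ 4 * |t| ^ 3 * ∫ ω, |X ω| ^ 3 ∂μ := by
  have hX₂ : MemLp X 2 μ := hX.mono_exponent (by norm_num)
  have hX_int : Integrable (fun ω => ((t * X ω : ℝ) : ℂ)) μ :=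
    ((hX.integrable (by norm_num)).const_mul t).ofReal
  have hX_sq_int : Integrable (fun ω => ((t * X ω : ℝ) : ℂ) ^ 2) μ := by
    exact_mod_cast (hX₂.const_mul t).integrable_sq.ofReal (𝕜 := ℂ)
  have hexp_int : Integrable (fun ω => Complex.exp ((t * X ω : ℝ) * Complex.I)) μ :=
    .of_bound (C := 1) (by have := hX.aemeasurable; fun_prop) (.of_forall fun ω => by
      rw [Complex.norm_exp_ofReal_mul_I])
  have htaylor_int : Integrable
      (fun ω => 1 + (t * X ω : ℝ) * Complex.I - (t * X ω : ℝ) ^ 2 / 2 : Ω → ℂ) μ :=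
    ((integrable_const _).add (hX_int.mul_const _)).sub (hX_sq_int.div_const _)
  rw [charFun_apply_real, integral_map hX.aemeasurable (by fun_prop),
    ← integral_taylor_two_cexp_mul_I hX₂ hmean t]
  simp_rw [← Complex.ofReal_mul]
  rw [← integral_sub hexp_int htaylor_int, ← integral_const_mul]
  refine norm_integral_le_of_norm_le ((integrable_abs_pow_three hX).const_mul _)
    (.of_forall fun ω => (norm_cexp_mul_I_sub_taylor_two_le (t * X ω)).trans_eq ?_)
  rw [abs_mul]
  ring

theorem norm_charFun_map_sub_exp_le {X : Ω → ℝ} (hX : MemLp X 3 μ) (hmean : μ[X] = 0) (t : ℝ) :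
    ‖charFun (μ.map X) t - Real.exp (-(Var[X; μ] * t ^ 2 / 2))‖
      ≤ 5 * |t| ^ 3 * ∫ ω, |X ω| ^ 3 ∂μ := by
  set u := √(Var[X; μ]) * t with hu
  have sq_eq : Var[X; μ] * t ^ 2 = u ^ 2 := by rw [hu, mul_pow, Real.sq_sqrt (variance_nonneg _ _)]
  have gaussian_taylor : ‖((1 - Var[X; μ] * t ^ 2 / 2 : ℝ) : ℂ)
      - Real.exp (-(Var[X; μ] * t ^ 2 / 2))‖ ≤ |t| ^ 3 * ∫ ω, |X ω| ^ 3 ∂μ := by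
    rw [← Complex.ofReal_sub, Complex.norm_real, Real.norm_eq_abs, abs_sub_comm, sq_eq]
    calc |Real.exp (-(u ^ 2 / 2)) - (1 - u ^ 2 / 2)| ≤ |u| ^ 3 := abs_exp_neg_sq_div_two_sub_le u
      _ = |t| ^ 3 * √(Var[X; μ]) ^ 3 := by
        rw [hu, abs_mul, abs_of_nonneg (Real.sqrt_nonneg _)]
        ring
      _ ≤ |t| ^ 3 * ∫ ω, |X ω| ^ 3 ∂μ := by
        gcongr
        exact sqrt_variance_pow_three_le hX hmean
  calc ‖charFun (μ.map X) t - Real.exp (-(Var[X; μ] * t ^ 2 / 2))‖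
      ≤ 4 * |t| ^ 3 * ∫ ω, |X ω| ^ 3 ∂μ + |t| ^ 3 * ∫ ω, |X ω| ^ 3 ∂μ :=
        (norm_sub_le_norm_sub_add_norm_sub _ _ _).trans
          (add_le_add (norm_charFun_map_sub_taylor_two_le hX hmean t) gaussian_taylor)
    _ = 5 * |t| ^ 3 * ∫ ω, |X ω| ^ 3 ∂μ := by ring

theorem norm_charFun_map_sum_sub_exp_le {ι : Type*} [Fintype ι] {X : ι → Ω → ℝ}
    (hX : ∀ i, MemLp (X i) 3 μ) (hmean : ∀ i, μ[X i] = 0) (hindep : iIndepFun X μ) (t : ℝ) :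
    ‖charFun (μ.map fun ω => ∑ i, X i ω) t - Real.exp (-((∑ i, Var[X i; μ]) * t ^ 2 / 2))‖
      ≤ 5 * |t| ^ 3 * ∑ i, ∫ ω, |X i ω| ^ 3 ∂μ := by
  have exp_eq_prod : (Real.exp (-((∑ i, Var[X i; μ]) * t ^ 2 / 2)) : ℂ)
      = ∏ i, (Real.exp (-(Var[X i; μ] * t ^ 2 / 2)) : ℂ) := by
    rw [← Complex.ofReal_prod, ← Real.exp_sum, Finset.sum_neg_distrib, Finset.sum_mul,
      Finset.sum_div]
  have norm_charFun_le (i : ι) : ‖charFun (μ.map (X i)) t‖ ≤ 1 :=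
    have := Measure.isProbabilityMeasure_map (hX i).aemeasurable
    norm_charFun_le_one t
  have norm_exp_le (i : ι) : ‖(Real.exp (-(Var[X i; μ] * t ^ 2 / 2)) : ℂ)‖ ≤ 1 := by
    rw [Complex.norm_real, Real.norm_of_nonneg (Real.exp_nonneg _), Real.exp_le_one_iff,
      neg_nonpos]
    exact div_nonneg (mul_nonneg (variance_nonneg _ _) (sq_nonneg t)) two_pos.le
  rw [hindep.charFun_map_fun_sum_eq_prod fun i => (hX i).aemeasurable, Finset.prod_apply,
    exp_eq_prod, Finset.mul_sum]
  exact (norm_prod_sub_prod_le_sum_norm_sub _ (fun i _ => norm_charFun_le i)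
    fun i _ => norm_exp_le i).trans
    (Finset.sum_le_sum fun i _ => norm_charFun_map_sub_exp_le (hX i) (hmean i) t)

end CharFun

section TriangularArrays

variable {ι : ℕ → Type*} [∀ n, Fintype (ι n)] {Ω : ℕ → Type*} [∀ n, MeasurableSpace (Ω n)]
  {μ : (n : ℕ) → Measure (Ω n)} [∀ n, IsProbabilityMeasure (μ n)]
  {Ω' : Type*} [MeasurableSpace Ω'] {μ' : Measure Ω'} [IsProbabilityMeasure μ']
  {X : (n : ℕ) → ι n → Ω n → ℝ} {Z : Ω' → ℝ}

/-- **Lyapunov's central limit theorem** with third moments. The total variance of a row tends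
to `v` instead of being divided out, since it may vanish in the early rows. -/
theorem tendstoInDistribution_sum_of_tendsto_abs_pow_three {v : ℝ≥0}
    (hZ : HasLaw Z (gaussianReal 0 v) μ') (hX : ∀ n i, MemLp (X n i) 3 (μ n))
    (hmean : ∀ n i, (μ n)[X n i] = 0) (hindep : ∀ n, iIndepFun (X n) (μ n))
    (hvar : Tendsto (fun n => ∑ i, Var[X n i; μ n]) atTop (𝓝 v))
    (hthird : Tendsto (fun n => ∑ i, ∫ ω, |X n i ω| ^ 3 ∂μ n) atTop (𝓝 0)) :
    TendstoInDistribution (fun n ω => ∑ i, X n i ω) atTop Z μ μ' where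
  forall_aemeasurable n := Finset.aemeasurable_fun_sum _ fun i _ => (hX n i).aemeasurable
  aemeasurable_limit := hZ.aemeasurable
  tendsto := by
    refine ProbabilityMeasure.tendsto_iff_tendsto_charFun.2 fun t => ?_
    have charFun_limit : charFun (μ'.map Z) t = Real.exp (-(v * t ^ 2 / 2)) := by
      rw [hZ.map_eq, charFun_gaussianReal]
      simp
    have tendsto_exp : Tendsto
        (fun n => (Real.exp (-((∑ i, Var[X n i; μ n]) * t ^ 2 / 2)) : ℂ)) atTop
        (𝓝 (Real.exp (-(v * t ^ 2 / 2)) : ℝ)) :=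
      (Complex.continuous_ofReal.tendsto _).comp <| (Real.continuous_exp.tendsto _).comp
        ((hvar.mul_const _).div_const _).neg
    have tendsto_sub : Tendsto (fun n => charFun ((μ n).map fun ω => ∑ i, X n i ω) t
        - Real.exp (-((∑ i, Var[X n i; μ n]) * t ^ 2 / 2))) atTop (𝓝 0) :=
      squeeze_zero_norm
        (fun n => norm_charFun_map_sum_sub_exp_le (hX n) (hmean n) (hindep n) t)
        (by simpa only [mul_zero] using hthird.const_mul (5 * |t| ^ 3))
    simpa only [ProbabilityMeasure.coe_mk, charFun_limit, sub_add_cancel, zero_add]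
      using tendsto_sub.add tendsto_exp

theorem tendstoInDistribution_sum_of_abs_le {v : ℝ≥0} (hZ : HasLaw Z (gaussianReal 0 v) μ')
    (hX : ∀ n i, AEMeasurable (X n i) (μ n)) (hmean : ∀ n i, (μ n)[X n i] = 0)
    (hindep : ∀ n, iIndepFun (X n) (μ n)) {b : ℕ → ℝ}
    (hb : ∀ n i, ∀ᵐ ω ∂μ n, |X n i ω| ≤ b n) (hb_lim : Tendsto b atTop (𝓝 0))
    (hvar : Tendsto (fun n => ∑ i, Var[X n i; μ n]) atTop (𝓝 v)) :
    TendstoInDistribution (fun n ω => ∑ i, X n i ω) atTop Z μ μ' := by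
  refine tendstoInDistribution_sum_of_tendsto_abs_pow_three hZ
    (fun n i => .of_bound (hX n i).aestronglyMeasurable (b n) (hb n i)) hmean hindep hvar ?_
  refine squeeze_zero
    (fun n => Finset.sum_nonneg fun i _ => integral_nonneg fun ω => by positivity)
    (fun n => ?_) (by simpa only [zero_mul] using hb_lim.mul hvar)
  rw [Finset.mul_sum]
  exact Finset.sum_le_sum fun i _ =>
    integral_abs_pow_three_le_mul_variance (hX n i) (hmean n i) (hb n i)

theorem tendstoInDistribution_sum_sub_mean_div_sqrt_variance
    (hZ : HasLaw Z (gaussianReal 0 1) μ') (hX : ∀ n i, AEMeasurable (X n i) (μ n))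
    (hindep : ∀ n, iIndepFun (X n) (μ n)) {C : ℝ} (hC : ∀ n i, ∀ᵐ ω ∂μ n, |X n i ω| ≤ C)
    (hsd : Tendsto (fun n => √(∑ i, Var[X n i; μ n])) atTop atTop) :
    TendstoInDistribution
      (fun n ω => (∑ i, X n i ω - ∑ i, (μ n)[X n i]) / √(∑ i, Var[X n i; μ n])) atTop Z μ μ' := by
  set s : ℕ → ℝ := fun n => √(∑ i, Var[X n i; μ n])
  have hX_int n i : Integrable (X n i) (μ n) := .of_bound (hX n i).aestronglyMeasurable C (hC n i)
  simp_rw [← Finset.sum_sub_distrib, Finset.sum_div]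
  refine tendstoInDistribution_sum_of_abs_le (X := fun n i ω => (X n i ω - (μ n)[X n i]) / s n)
    (b := fun n => 2 * C / s n) hZ (fun n i => ((hX n i).sub_const _).div_const _) ?_
    (fun n => (hindep n).comp (fun i x => (x - ∫ ω, X n i ω ∂μ n) / s n) (by fun_prop))
    ?_ (hsd.const_div_atTop _) ?_
  · intro n i
    rw [integral_div, integral_sub (hX_int n i) (integrable_const _), integral_const,
      probReal_univ, one_smul, sub_self, zero_div]
  · intro n i
    have mean_le : |(μ n)[X n i]| ≤ C := by
      simpa using norm_integral_le_of_norm_le_const (f := X n i) (hC n i)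
    filter_upwards [hC n i] with ω hω
    rw [abs_div, abs_of_nonneg (Real.sqrt_nonneg _), two_mul]
    gcongr
    exact (abs_sub _ _).trans (add_le_add hω mean_le)
  · have var_eq n i : Var[fun ω => (X n i ω - (μ n)[X n i]) / s n; μ n]
        = Var[X n i; μ n] / s n ^ 2 := by
      simp_rw [div_eq_mul_inv]
      rw [variance_mul_const, variance_sub_const (hX n i).aestronglyMeasurable, inv_pow]
    refine tendsto_const_nhds.congr' ?_
    filter_upwards [hsd.eventually_gt_atTop 0] with n hn
    simp_rw [var_eq]
    rw [← Finset.sum_div, Real.sq_sqrt (Finset.sum_nonneg fun i _ => variance_nonneg _ _),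
      NNReal.coe_one, div_self (Real.sqrt_pos.1 hn).ne']

end TriangularArrays

section Agreement

instance Treatment.instFinite : Finite Treatment :=
  .of_surjective (fun b : Bool => if b then .A else .B) fun
    | .A => ⟨true, rfl⟩
    | .B => ⟨false, rfl⟩

instance Treatment.instDiscreteMeasurableSpace : DiscreteMeasurableSpace Treatment :=
  ⟨fun _ => trivial⟩

/-- The contribution `±1` of one actor with assigned treatment `a` and received treatment `b` to
`n_S - n_D`. -/
def agreementSign (a b : Treatment) : ℝ :=
  if a = b then 1 else -1

theorem abs_agreementSign (a b : Treatment) : |agreementSign a b| = 1 := by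
  unfold agreementSign
  split_ifs <;> norm_num

theorem agreementSign_sq (a b : Treatment) : agreementSign a b ^ 2 = 1 := by
  rw [← sq_abs, abs_agreementSign, one_pow]

theorem numSame_sub_numDiff {n : ℕ} (c d : Fin n → Treatment) :
    (numSame c d : ℝ) - numDiff c d = ∑ i, agreementSign (c i) (d i) := by
  have sign_eq (i : Fin n) : agreementSign (c i) (d i) = 2 * (if c i = d i then 1 else 0) - 1 := by
    unfold agreementSign
    split_ifs <;> norm_num
  have numSame_eq : (numSame c d : ℝ) = ∑ i, if c i = d i then 1 else 0 := by simp [numSame]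
  simp_rw [numDiff, Nat.cast_sub (numSame_le c d), sign_eq, Finset.sum_sub_distrib,
    ← Finset.mul_sum, ← numSame_eq, Finset.sum_const, Finset.card_univ, Fintype.card_fin,
    nsmul_one]
  ring

theorem agreementSign_eq_one_sub_indicator {Ω : Type*} (c d : Ω → Treatment) (ω : Ω) :
    agreementSign (c ω) (d ω) = 1 - 2 * {ω | d ω ≠ c ω}.indicator 1 ω := by
  by_cases h : c ω = d ω
  · simp [agreementSign, h]
  · norm_num [agreementSign, h, Ne.symm h]

end Agreement

namespace IsBernoulliSwitching

variable {Ω : Type*} [MeasurableSpace Ω] {μ : Measure Ω} {n : ℕ} {p : Fin n → ℝ}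
  {c d : Fin n → Ω → Treatment}

theorem measurableSet_ne (h : IsBernoulliSwitching μ p c d) (i : Fin n) :
    MeasurableSet {ω | d i ω ≠ c i ω} :=
  (measurableSet_eq_fun (h.measurable_received i) (h.measurable_assigned i)).compl

theorem measurable_agreementSign (h : IsBernoulliSwitching μ p c d) (i : Fin n) :
    Measurable fun ω => agreementSign (c i ω) (d i ω) :=
  (measurable_of_countable fun x : Treatment × Treatment => agreementSign x.1 x.2).comp
    ((h.measurable_assigned i).prodMk (h.measurable_received i))

theorem iIndepFun_agreementSign (h : IsBernoulliSwitching μ p c d) :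
    iIndepFun (fun i ω => agreementSign (c i ω) (d i ω)) μ := by
  simp_rw [agreementSign_eq_one_sub_indicator]
  exact (h.indep.iIndepFun_indicator (β := ℝ)).comp (fun _ x => 1 - 2 * x) fun _ => by fun_prop

theorem integral_agreementSign [IsProbabilityMeasure μ] (h : IsBernoulliSwitching μ p c d)
    (i : Fin n) : ∫ ω, agreementSign (c i ω) (d i ω) ∂μ = 1 - 2 * p i := by
  simp_rw [agreementSign_eq_one_sub_indicator]
  rw [integral_sub (integrable_const _)
      (((integrable_const _).indicator (h.measurableSet_ne i)).const_mul _),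
    integral_const_mul, integral_indicator_one (h.measurableSet_ne i), h.prob, integral_const,
    probReal_univ, one_smul]

theorem variance_agreementSign [IsProbabilityMeasure μ] (h : IsBernoulliSwitching μ p c d)
    (i : Fin n) : Var[fun ω => agreementSign (c i ω) (d i ω); μ] = 4 * (p i * (1 - p i)) := by
  have hmemLp : MemLp (fun ω => agreementSign (c i ω) (d i ω)) 2 μ :=
    .of_bound (h.measurable_agreementSign i).aestronglyMeasurable 1 (.of_forall fun ω =>
      (abs_agreementSign _ _).le)
  simp_rw [variance_eq_sub hmemLp, h.integral_agreementSign, Pi.pow_apply, agreementSign_sq]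
  rw [integral_const, probReal_univ, one_smul]
  ring

theorem sum_integral_agreementSign [IsProbabilityMeasure μ] (h : IsBernoulliSwitching μ p c d) :
    ∑ i, ∫ ω, agreementSign (c i ω) (d i ω) ∂μ = switchingMean p := by
  simp [h.integral_agreementSign, switchingMean, Finset.sum_sub_distrib, Finset.mul_sum]

theorem sqrt_sum_variance_agreementSign [IsProbabilityMeasure μ]
    (h : IsBernoulliSwitching μ p c d) :
    √(∑ i, Var[fun ω => agreementSign (c i ω) (d i ω); μ]) = 2 * switchingSD p := by
  simp_rw [h.variance_agreementSign, ← Finset.mul_sum]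
  rw [switchingSD, Real.sqrt_mul zero_le_four, (by norm_num : (4 : ℝ) = 2 ^ 2),
    Real.sqrt_sq zero_le_two]

end IsBernoulliSwitching

theorem theorem3 {Ω : ℕ → Type*} [∀ n, MeasurableSpace (Ω n)]
    (μ : (n : ℕ) → Measure (Ω n)) [∀ n, IsProbabilityMeasure (μ n)]
    (p : (n : ℕ) → Fin n → ℝ) (c d : (n : ℕ) → Fin n → Ω n → Treatment)
    (hswitch : ∀ n, IsBernoulliSwitching (μ n) (p n) (c n) (d n))
    (hs : Tendsto (fun n => switchingSD (p n)) atTop atTop) :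
    TendstoInDistribution
      (fun n ω => ((numSame (fun i => c n i ω) (fun i => d n i ω) : ℝ)
          - (numDiff (fun i => c n i ω) (fun i => d n i ω) : ℝ) - switchingMean (p n))
        / (2 * switchingSD (p n)))
      atTop (id : ℝ → ℝ) μ (gaussianReal 0 1) := by
  have hsd : Tendsto
      (fun n => √(∑ i, Var[fun ω => agreementSign (c n i ω) (d n i ω); μ n])) atTop atTop := by
    simpa only [(hswitch _).sqrt_sum_variance_agreementSign] using hs.const_mul_atTop two_pos
  have clt := tendstoInDistribution_sum_sub_mean_div_sqrt_variance
    (HasLaw.id (μ := gaussianReal 0 1))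
    (fun n i => ((hswitch n).measurable_agreementSign i).aemeasurable)
    (fun n => (hswitch n).iIndepFun_agreementSign)
    (fun n i => .of_forall fun ω => (abs_agreementSign _ _).le) hsd
  simpa only [numSame_sub_numDiff, (hswitch _).sum_integral_agreementSign,
    (hswitch _).sqrt_sum_variance_agreementSign] using clt
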